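/- Let $n\ge 1$, let $\sigma_0=I,\sigma_1=X,\sigma_2=Y,\sigma_3=Z$ be the Pauli matrices, let $\sigma_{(i_1,\dots,i_n)}=\sigma_{i_1}\otimes\cdots\otimes\sigma_{i_n}$, and let $\rho_{\rm in}\in\mathbb C^{2^n\times 2^n}$ be an $n$-qubit density matrix (positive semidefinite, trace $1$). Put $$\alpha(\rho_{\rm in})=\mathrm{Tr}[\sigma_{(1,0,\dots,0)}\rho_{\rm in}]^2+\mathrm{Tr}[\sigma_{(3,0,\dots,0)}\rho_{\rm in}]^2 .$$ Circuits consist of rotations $e^{-i\theta\sigma_2}$, each with its own parameter $\theta$, and of CNOT gates $|0\rangle\langle0|\otimes\sigma_0+|1\rangle\langle1|\otimes\sigma_1$ (control $\otimes$ target). For a circuit with operator $V(\boldsymbol\theta)$ let $$f(\boldsymbol\theta)=\tfrac12+\tfrac12\,\mathrm{Tr}\big[\sigma_{(3,0,\dots,0)}\,V(\boldsymbol\theta)\,\rho_{\rm in}\,V(\boldsymbol\theta)^\dagger\big],$$ and let $\mathbb E_{\boldsymbol\theta}$ be the expectation over independent parameters, each uniform on $[0,2\pi]$. The functions $f$ below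 are differentiable and the expectations below are finite. (TT) Let $n=2^m$ with $m\ge 0$. The tree-tensor circuit $V_{\rm TT}$ first rotates every qubit; then, for $\ell=1,\dots,m$ in this order, it applies for every $j\in\{0,\dots,n2^{-\ell}-1\}$ a CNOT with target qubit $j2^{\ell}+1$ and control qubit $j2^{\ell}+2^{\ell-1}+1$, and then rotates each of these target qubits. It has $2n-1$ parameters, and its objective function $f_{\rm TT}$ satisfies $$\frac{1+\log_2 n}{2n}\,\alpha(\rho_{\rm in})\;\le\;\mathbb E_{\boldsymbol\theta}\|\nabla_{\boldsymbol\theta}f_{\rm TT}\|^2\;\le\;2n-1 .$$ (SC) Let $n_c$ be an integer with $1\le n_c\le n-1$ (or $n_c=0$ if $n=1$). The step-controlled circuit $V_{\rm SC}$ first rotates every qubit; then, for $c=n,n-1,\dots,2$ in this order, it applies a CNOT with control qubit $c$ and target qubit $t(c)$ and then rotates qubit $t(c)$, where $t(c)=c-1$ if $c>n_c+1$ and $t(c)=1$ if $c\le n_c+1$. Thus exactly $n_c$ CNOTs act on the first qubit. It has $2n-1$ parameters, and its objective function $f_{\rm SC}$ satisfies $$\frac{1+n_c}{2^{1+n_c}}\,\alpha(\rho_{\rm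 in})\;\le\;\mathbb E_{\boldsymbol\theta}\|\nabla_{\boldsymbol\theta}f_{\rm SC}\|^2\;\le\;2n-1 .$$ -/

import Mathlib

open MeasureTheory
open scoped ComplexOrder

noncomputable section

namespace QNN

/-- Operators on the `n`-qubit space, as matrices over the computational basis of `n`-bit strings
(`2 ^ n` basis vectors).  Qubits are numbered `0, …, n - 1`; the first qubit is qubit `0`. -/
abbrev QMatrix (n : ℕ) : Type := Matrix (Fin n → Fin 2) (Fin n → Fin 2) ℂ

/-- The tensor product `A 0 ⊗ A 1 ⊗ ⋯ ⊗ A (n - 1)` of single-qubit operators. -/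
def tensor {n : ℕ} (A : Fin n → Matrix (Fin 2) (Fin 2) ℂ) : QMatrix n :=
  Matrix.of fun x y => ∏ k, A k (x k) (y k)

/-- The Pauli matrices `σ₀ = I, σ₁ = X, σ₂ = Y, σ₃ = Z`. -/
def pauli : Fin 4 → Matrix (Fin 2) (Fin 2) ℂ :=
  ![1, !![0, 1; 1, 0], !![0, -Complex.I; Complex.I, 0], !![1, 0; 0, -1]]

/-- The Pauli string `σ_{i₁} ⊗ ⋯ ⊗ σ_{iₙ}`. -/
def pauliString {n : ℕ} (i : Fin n → Fin 4) : QMatrix n :=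
  tensor fun k => pauli (i k)

/-- The Pauli string with `σ_i` on the first qubit and `σ₀` on all others. -/
def firstPauli {n : ℕ} [NeZero n] (i : Fin 4) : QMatrix n :=
  pauliString (Pi.single 0 i)

/-- The rotation `e^{-iθσ₂}` (matrix exponential). -/
def rotY (θ : ℝ) : Matrix (Fin 2) (Fin 2) ℂ :=
  NormedSpace.exp ((-(Complex.I * (θ : ℂ))) • pauli 2)

/-- The single-qubit operator `A` acting on qubit `q`, tensored with the identity elsewhere. -/
def onQubit {n : ℕ} (q : Fin n) (A : Matrix (Fin 2) (Fin 2) ℂ) : QMatrix n :=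
  tensor (Function.update (fun _ => 1) q A)

/-- CNOT with the given control and target:
`|0⟩⟨0|` on the control, plus `|1⟩⟨1|` on the control tensored with `σ₁` on the target. -/
def cnotMatrix {n : ℕ} (control target : Fin n) : QMatrix n :=
  onQubit control !![1, 0; 0, 0] + onQubit control !![0, 0; 0, 1] * onQubit target (pauli 1)

/-- The gates of a parameterized circuit on `n` qubits whose parameters are labelled by `P`. -/
inductive Gate (n : ℕ) (P : Type) : Type
  /-- the rotation `e^{-iθσ₂}` on the qubit `q`, where `θ` is the value of the parameter `p` -/
  | ry (p : P) (q : Fin n) : Gate n P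
  /-- CNOT -/
  | cnot (control target : Fin n) (h : control ≠ target) : Gate n P

/-- The operator of a gate at the parameter values `θ`. -/
def Gate.toMatrix {n : ℕ} {P : Type} (θ : P → ℝ) : Gate n P → QMatrix n
  | .ry p q => onQubit q (rotY (θ p))
  | .cnot c t _ => cnotMatrix c t

/-- The operator `V(θ)` of a circuit; the head of the list is the gate that is applied first. -/
def circuitMatrix {n : ℕ} {P : Type} (θ : P → ℝ) : List (Gate n P) → QMatrix n
  | [] => 1
  | g :: C => circuitMatrix θ C * g.toMatrix θ

/-! ### The tree-tensor circuit -/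

/-- Parameters of the tree-tensor circuit on `2 ^ m` qubits: the layers are `ℓ = 0, …, m`,
and layer `ℓ` has `2 ^ m / 2 ^ ℓ` parameters. -/
abbrev TTParam (m : ℕ) : Type := Σ ℓ : Fin (m + 1), Fin (2 ^ (m - (ℓ : ℕ)))

theorem tt_rot_lt {n m : ℕ} (hn : n = 2 ^ m) (ℓ : Fin (m + 1)) (j : Fin (2 ^ (m - (ℓ : ℕ)))) :
    (j : ℕ) * 2 ^ (ℓ : ℕ) < n := by
  have h : 2 ^ (m - (ℓ : ℕ)) * 2 ^ (ℓ : ℕ) = 2 ^ m := by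
    rw [← pow_add, Nat.sub_add_cancel (by omega)]
  rw [hn, ← h]
  exact Nat.mul_lt_mul_of_pos_right j.2 (by positivity)

theorem tt_control_lt {n m : ℕ} (hn : n = 2 ^ m) (ℓ : Fin m) (j : Fin (2 ^ (m - ((ℓ : ℕ) + 1)))) :
    (j : ℕ) * 2 ^ ((ℓ : ℕ) + 1) + 2 ^ (ℓ : ℕ) < n := by
  have h : 2 ^ (m - ((ℓ : ℕ) + 1)) * 2 ^ ((ℓ : ℕ) + 1) = 2 ^ m := by
    rw [← pow_add, Nat.sub_add_cancel (by omega)]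
  have h1 : ((j : ℕ) + 1) * 2 ^ ((ℓ : ℕ) + 1) ≤ 2 ^ (m - ((ℓ : ℕ) + 1)) * 2 ^ ((ℓ : ℕ) + 1) :=
    Nat.mul_le_mul_right _ j.2
  have h2 : 2 ^ (ℓ : ℕ) < 2 ^ ((ℓ : ℕ) + 1) := Nat.pow_lt_pow_right (by norm_num) (by omega)
  rw [add_mul, one_mul] at h1
  omega

/-- Rotation layer `ℓ` of the tree: parameter `j` of the layer rotates qubit `j * 2 ^ ℓ`. -/
def ttRotLayer {n m : ℕ} (hn : n = 2 ^ m) (ℓ : Fin (m + 1)) : List (Gate n (TTParam m)) :=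
  List.ofFn fun j : Fin (2 ^ (m - (ℓ : ℕ))) =>
    Gate.ry ⟨ℓ, j⟩ ⟨(j : ℕ) * 2 ^ (ℓ : ℕ), tt_rot_lt hn ℓ j⟩

/-- CNOT layer that follows rotation layer `ℓ`: the target is qubit `j * 2 ^ (ℓ + 1)` and the
control is qubit `j * 2 ^ (ℓ + 1) + 2 ^ ℓ`, for `j < n / 2 ^ (ℓ + 1)`. -/
def ttCnotLayer {n m : ℕ} (hn : n = 2 ^ m) (ℓ : Fin m) : List (Gate n (TTParam m)) :=
  List.ofFn fun j : Fin (2 ^ (m - ((ℓ : ℕ) + 1))) =>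
    Gate.cnot
      ⟨(j : ℕ) * 2 ^ ((ℓ : ℕ) + 1) + 2 ^ (ℓ : ℕ), tt_control_lt hn ℓ j⟩
      ⟨(j : ℕ) * 2 ^ ((ℓ : ℕ) + 1), lt_of_le_of_lt (Nat.le_add_right _ _) (tt_control_lt hn ℓ j)⟩
      (by
        intro h
        have h1 := congrArg Fin.val h
        have h2 : 0 < 2 ^ (ℓ : ℕ) := by positivity
        simp only at h1
        omega)

/-- The tree-tensor circuit on `n = 2 ^ m` qubits: a rotation layer on all qubits, followed by
`m` times a CNOT layer and a rotation layer on the targets of these CNOTs. -/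
def ttCircuit {n m : ℕ} (hn : n = 2 ^ m) : List (Gate n (TTParam m)) :=
  ttRotLayer hn 0 ++
    (List.finRange m).flatMap fun ℓ => ttCnotLayer hn ℓ ++ ttRotLayer hn ℓ.succ

/-! ### The step-controlled circuit -/

/-- Parameters of the step-controlled circuit: `n` for the rotations of the first layer, and one
for the rotation that follows each of the `n - 1` CNOTs. -/
abbrev SCParam (n : ℕ) : Type := Fin n ⊕ Fin (n - 1)

/-- The qubit that controls the CNOT number `i`: these are `n - 1, n - 2, …, 1` in this order. -/
def scControl (n : ℕ) (i : Fin (n - 1)) : Fin n := ⟨n - 1 - (i : ℕ), by omega⟩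

/-- The target of the CNOT number `i`, with control `c`: the adjacent qubit `c - 1` while
`c > nc`, and the first qubit for the last `nc` CNOTs, whose controls are `nc, …, 1`. -/
def scTarget (n nc : ℕ) (i : Fin (n - 1)) : Fin n :=
  ⟨if nc < n - 1 - (i : ℕ) then n - 1 - (i : ℕ) - 1 else 0, by split_ifs <;> omega⟩

theorem scControl_ne_scTarget (n nc : ℕ) (i : Fin (n - 1)) :
    scControl n i ≠ scTarget n nc i := by
  intro h
  have h1 := congrArg Fin.val h
  simp only [scControl, scTarget] at h1
  split_ifs at h1 <;> omega

/-- The step-controlled circuit: a rotation layer on all qubits, followed by `n - 1` CNOTs, each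
of them followed by a rotation of its target. -/
def scCircuit (n nc : ℕ) : List (Gate n (SCParam n)) :=
  (List.ofFn fun q : Fin n => Gate.ry (Sum.inl q) q) ++
    (List.finRange (n - 1)).flatMap fun i =>
      [Gate.cnot (scControl n i) (scTarget n nc i) (scControl_ne_scTarget n nc i),
        Gate.ry (Sum.inr i) (scTarget n nc i)]

/-! ### Objective function, expectation, and the constant of the input state -/

/-- A quantum state (density matrix). -/
def IsState {n : ℕ} (ρ : QMatrix n) : Prop := ρ.PosSemidef ∧ ρ.trace = 1

/-- The objective function `f(θ) = 1/2 + 1/2 Tr[(σ₃ ⊗ I ⊗ ⋯ ⊗ I) V(θ) ρ V(θ)†]`.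
The trace is real for Hermitian `ρ`. -/
def objective {n : ℕ} [NeZero n] {P : Type} (C : List (Gate n P)) (ρ : QMatrix n)
    (θ : EuclideanSpace ℝ P) : ℝ :=
  1 / 2 + 1 / 2 *
    (firstPauli 3 * circuitMatrix θ C * ρ * (circuitMatrix θ C).conjTranspose).trace.re

/-- The law of independent parameters, each uniform on `[0, 2π]`. -/
def uniformParams (P : Type) [Fintype P] : Measure (P → ℝ) :=
  Measure.pi fun _ => ProbabilityTheory.cond volume (Set.Icc (0 : ℝ) (2 * Real.pi))

/-- The squared Euclidean norm of the gradient of `f` at `θ`. -/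
def sqGradNorm {P : Type} [Fintype P] (f : EuclideanSpace ℝ P → ℝ) (θ : P → ℝ) : ℝ :=
  ‖gradient f (WithLp.toLp 2 θ)‖ ^ 2

/-- `α(ρ) = Tr[σ_(1,0,…,0) ρ]² + Tr[σ_(3,0,…,0) ρ]²`; both traces are real for Hermitian `ρ`. -/
def alpha {n : ℕ} [NeZero n] (ρ : QMatrix n) : ℝ :=
  (firstPauli 1 * ρ).trace.re ^ 2 + (firstPauli 3 * ρ).trace.re ^ 2

end QNN

end

/-!
Read the Bloch vector of the first qubit in the `X`-`Z` plane as a complex number. A rotation of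
the first qubit by `θ` multiplies it by `e^{-2iθ}`, so averaging over `θ` splits its second moment
equally between the two components. A CNOT with the first qubit as its target preserves the `X`
component, hence the CNOT and the rotation after it lose at most half of the second moment; all
other gates, as long as the first qubit is never a control, do not change the Bloch vector.

Along a single parameter the objective is a combination of `1`, `cos 2θ` and `sin 2θ`, so its
partial derivative is a difference of its values at the shifts `± π / 4`. Hence it is at most `1`
in absolute value, which gives the upper bound. For a rotation of the first qubit, the same
difference makes the Bloch vector turn by a right angle, which exchanges two components with equal
second moments. If `k` CNOTs act on the first qubit, each of its `1 + k` rotations therefore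
contributes at least `α / 2 ^ (1 + k)`.
-/

noncomputable section

namespace QNN

open Matrix Set

/-! ### Linear algebra and calculus -/

theorem one_sub_add_mul_mem_unitary {R : Type*} [Ring R] [StarRing R] {p u : R}
    (hp : IsStarProjection p) (hu : u ∈ unitary R) (h : Commute p u) :
    1 - p + p * u ∈ unitary R := by
  have hpp : p * p = p := hp.isIdempotentElem
  have hstar : star (1 - p + p * u) = 1 - p + p * star u := by
    rw [star_add, star_sub, star_one, h.eq, star_mul, hp.isSelfAdjoint.star_eq]
  have hpu : Commute p (star u) := by
    simpa only [hp.isSelfAdjoint.star_eq] using h.star_star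
  have hmul : ∀ a b : R, Commute p a → a * b = 1 →
      (1 - p + p * a) * (1 - p + p * b) = 1 := fun a b ha hab => by
    have hap : p * a * p = p * a := by rw [mul_assoc, ← ha.eq, ← mul_assoc, hpp]
    have hcross : p * a * (p * b) = p := by rw [← mul_assoc, hap, mul_assoc, hab, mul_one]
    simp only [add_mul, mul_add, sub_mul, mul_sub, one_mul, mul_one, hpp, hap, hcross,
      ← mul_assoc p p b]
    abel
  rw [Unitary.mem_iff, hstar]
  exact ⟨hmul _ _ hpu (Unitary.star_mul_self_of_mem hu),
    hmul _ _ h (Unitary.mul_star_self_of_mem hu)⟩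

theorem abs_re_trace_mul_le {m 𝕜 : Type*} [Fintype m] [DecidableEq m] [RCLike 𝕜]
    {A σ : Matrix m m 𝕜} (hA : A.IsHermitian) (hAA : A * A = 1) (hσ : σ.PosSemidef) :
    |RCLike.re (A * σ).trace| ≤ RCLike.re σ.trace := by
  have key : ∀ B : Matrix m m 𝕜, B.IsHermitian → B * B = 1 →
      -RCLike.re (B * σ).trace ≤ RCLike.re σ.trace := fun B hB hBB => by
    have hpos := (RCLike.le_iff_re_im.1
      (hσ.mul_mul_conjTranspose_same (1 + B)).trace_nonneg).1
    have hsq : (1 + B)ᴴ * (1 + B) = (2 : ℝ) • (1 + B) := by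
      rw [conjTranspose_add, conjTranspose_one, hB.eq, add_mul, mul_add, mul_add, hBB]
      simp only [one_mul, mul_one, two_smul]
      abel
    rw [trace_mul_comm, ← mul_assoc, hsq, smul_mul_assoc, trace_smul, add_mul, one_mul, trace_add,
      RCLike.smul_re, map_add, map_zero] at hpos
    linarith
  refine abs_le'.2 ⟨?_, key A hA hAA⟩
  simpa using key (-A) hA.neg (by simpa using hAA)

theorem exp_mem_unitaryGroup_of_conjTranspose_eq_neg {m 𝕜 : Type*} [Fintype m] [DecidableEq m]
    [RCLike 𝕜] {A : Matrix m m 𝕜} (hA : Aᴴ = -A) : NormedSpace.exp A ∈ unitaryGroup m 𝕜 := by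
  have hdet : IsUnit (NormedSpace.exp A).det := (isUnit_iff_isUnit_det _).1 (isUnit_exp A)
  rw [mem_unitaryGroup_iff, star_eq_conjTranspose, ← exp_conjTranspose, hA, Matrix.exp_neg,
    mul_nonsing_inv _ hdet]

theorem hasDerivAt_of_eq_cos_add_sin {E : Type*} [NormedAddCommGroup E] [NormedSpace ℝ E]
    {F : ℝ → E} {a b c : E}
    (hF : ∀ t, F t = a + Real.cos (2 * t) • b + Real.sin (2 * t) • c) :
    HasDerivAt F (F (Real.pi / 4) - F (-(Real.pi / 4))) 0 := by
  have hquarter : 2 * (Real.pi / 4) = Real.pi / 2 := by ring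
  have hlin : HasDerivAt (fun t : ℝ => 2 * t) 2 0 := by
    simpa using (hasDerivAt_id (0 : ℝ)).const_mul 2
  have hderiv : HasDerivAt F ((-Real.sin (2 * 0) * 2) • b + (Real.cos (2 * 0) * 2) • c) 0 :=
    funext hF ▸ ((hlin.cos.smul_const b).const_add a).add (hlin.sin.smul_const c)
  convert hderiv using 1
  rw [hF, hF, mul_neg, hquarter]
  simp [two_smul]

theorem hasDerivAt_add_smul_single_gradient {P : Type*} [Fintype P] [DecidableEq P]
    {f : EuclideanSpace ℝ P → ℝ} {x : EuclideanSpace ℝ P} (hf : DifferentiableAt ℝ f x) (p : P) :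
    HasDerivAt (fun t : ℝ => f (x + t • EuclideanSpace.single p 1)) (gradient f x p) 0 := by
  have hline : HasLineDerivAt ℝ f _ x (EuclideanSpace.single p 1) :=
    hf.hasGradientAt.hasFDerivAt.hasLineDerivAt _
  rw [InnerProductSpace.toDual_apply_apply, EuclideanSpace.inner_single_right] at hline
  rw [one_mul, conj_trivial] at hline
  exact hline

/-! ### Averages over independent parameters -/

theorem integral_eval_mul_of_dependsOn {P 𝕜 : Type*} [Fintype P] [RCLike 𝕜] {X : P → Type*}
    [∀ p, MeasurableSpace (X p)] (μ : ∀ p, Measure (X p)) [∀ p, IsProbabilityMeasure (μ p)]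
    (p : P) {h : X p → 𝕜} (hh : Measurable h) {F : (∀ q, X q) → 𝕜} (hF : Measurable F)
    (hFp : DependsOn F {p}ᶜ) :
    ∫ θ, h (θ p) * F θ ∂Measure.pi μ = (∫ t, h t ∂μ p) * ∫ θ, F θ ∂Measure.pi μ := by
  classical
  have : ∀ q, Nonempty (X q) := fun q => (μ q).nonempty_of_neZero
  obtain ⟨θ₀⟩ : Nonempty (∀ q, X q) := inferInstance
  have hind : ProbabilityTheory.iIndepFun (fun q (θ : ∀ q, X q) => θ q) (Measure.pi μ) :=
    ProbabilityTheory.iIndepFun_pi (X := fun _ x => x) fun _ => aemeasurable_id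
  have hFeq : F = (F ∘ Function.updateFinset θ₀ {p}ᶜ) ∘ (({p}ᶜ : Finset P).restrict) :=
    funext fun θ => hFp fun q hq => by
      simp [Function.updateFinset, show q ≠ p from hq]
  have hpair := (hind.indepFun_finset {p} {p}ᶜ disjoint_compl_right measurable_pi_apply).comp
    (φ := fun η : ∀ q : ({p} : Finset P), X q => h (η ⟨p, Finset.mem_singleton_self p⟩))
    (ψ := F ∘ Function.updateFinset θ₀ {p}ᶜ)
    (hh.comp (measurable_pi_apply _)) (hF.comp measurable_updateFinset)
  have hpair' : ProbabilityTheory.IndepFun (fun θ : ∀ q, X q => h (θ p)) F (Measure.pi μ) := by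
    rw [hFeq]
    exact hpair
  rw [hpair'.integral_fun_mul_eq_mul_integral
    (hh.comp (measurable_pi_apply p)).aestronglyMeasurable hF.aestronglyMeasurable,
    integral_comp_eval hh.aestronglyMeasurable]

section UniformLaw

variable {P : Type} [Fintype P]

instance isProbabilityMeasure_cond_Icc_two_pi :
    IsProbabilityMeasure (ProbabilityTheory.cond volume (Icc (0 : ℝ) (2 * Real.pi))) :=
  ProbabilityTheory.cond_isProbabilityMeasure_of_finite (by simp [Real.pi_pos])
    (by simp [ENNReal.mul_eq_top])

instance isProbabilityMeasure_uniformParams : IsProbabilityMeasure (uniformParams P) := by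
  unfold uniformParams
  infer_instance

theorem integrable_uniformParams {E : Type*} [NormedAddCommGroup E] {F : (P → ℝ) → E}
    (hF : Continuous F) : Integrable F (uniformParams P) := by
  have hmem : ∀ᵐ θ ∂uniformParams P, θ ∈ univ.pi fun _ : P => Icc (0 : ℝ) (2 * Real.pi) := by
    simp only [mem_univ_pi]
    exact ae_all_iff.2 fun p => Measure.tendsto_eval_ae_ae.eventually
      (ProbabilityTheory.ae_cond_mem measurableSet_Icc)
  rw [← Measure.restrict_eq_self_of_ae_mem hmem]
  exact hF.continuousOn.integrableOn_compact (isCompact_univ_pi fun _ => isCompact_Icc)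

theorem integral_cond_Icc_exp_four_mul :
    ∫ t : ℝ, Complex.exp (-4 * Complex.I * t)
      ∂ProbabilityTheory.cond volume (Icc 0 (2 * Real.pi)) = 0 := by
  have hperiod : Complex.exp (-4 * Complex.I * (2 * Real.pi : ℝ)) = 1 :=
    Complex.exp_eq_one_iff.2 ⟨-4, by push_cast; ring⟩
  rw [ProbabilityTheory.cond, integral_smul_measure, integral_Icc_eq_integral_Ioc,
    ← intervalIntegral.integral_of_le (by positivity), integral_exp_mul_complex (by simp),
    hperiod]
  simp

/-- The second moments of the real and of the imaginary part of a complex random variable under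
the law of the parameters. -/
def secondMoments (z : (P → ℝ) → ℂ) : ℝ × ℝ :=
  (∫ θ, (z θ).re ^ 2 ∂uniformParams P, ∫ θ, (z θ).im ^ 2 ∂uniformParams P)

theorem secondMoments_const (c : ℂ) :
    secondMoments (P := P) (fun _ => c) = (c.re ^ 2, c.im ^ 2) := by
  simp [secondMoments]

theorem secondMoments_neg_I_mul (z : (P → ℝ) → ℂ) :
    secondMoments (fun θ => -Complex.I * z θ) = (secondMoments z).swap := by
  simp [secondMoments]

theorem integral_sq_exp_mul {p : P} {z : (P → ℝ) → ℂ} (hz : Continuous z)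
    (hzp : DependsOn z {p}ᶜ) :
    ∫ θ, (Complex.exp (-2 * Complex.I * θ p) * z θ) ^ 2 ∂uniformParams P = 0 := by
  have hsq : ∀ θ, (Complex.exp (-2 * Complex.I * θ p) * z θ) ^ 2 =
      Complex.exp (-4 * Complex.I * θ p) * z θ ^ 2 := fun θ => by
    rw [mul_pow, ← Complex.exp_nat_mul]
    ring_nf
  simp only [hsq]
  rw [uniformParams, integral_eval_mul_of_dependsOn _ p
    (h := fun t : ℝ => Complex.exp (-4 * Complex.I * t)) (F := fun θ => z θ ^ 2) (by fun_prop)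
    (hz.pow 2).measurable fun _ _ h => congrArg (· ^ 2) (hzp h), integral_cond_Icc_exp_four_mul,
    zero_mul]

theorem secondMoments_exp_mul {p : P} {z : (P → ℝ) → ℂ} (hz : Continuous z)
    (hzp : DependsOn z {p}ᶜ) :
    secondMoments (fun θ => Complex.exp (-2 * Complex.I * θ p) * z θ) =
      (((secondMoments z).1 + (secondMoments z).2) / 2,
        ((secondMoments z).1 + (secondMoments z).2) / 2) := by
  set w : (P → ℝ) → ℂ := fun θ => Complex.exp (-2 * Complex.I * θ p) * z θ
  have hw : Continuous w := by fun_prop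
  have hsq : ∫ θ, (w θ ^ 2).re ∂uniformParams P = 0 := by
    have hre := integral_re (𝕜 := ℂ) (f := fun θ => w θ ^ 2)
      (integrable_uniformParams (P := P) (by fun_prop))
    rwa [integral_sq_exp_mul hz hzp, map_zero] at hre
  have hnorm : ∀ θ, (w θ).re ^ 2 + (w θ).im ^ 2 = (z θ).re ^ 2 + (z θ).im ^ 2 := fun θ => by
    have : Complex.normSq (w θ) = Complex.normSq (z θ) := by
      simp [w, Complex.normSq_eq_norm_sq, Complex.norm_exp]
    simpa only [Complex.normSq_apply, ← sq] using this
  have hsplit : ∀ θ, (w θ ^ 2).re = (w θ).re ^ 2 - (w θ).im ^ 2 := fun θ => by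
    simp [sq]
  have hadd : (secondMoments w).1 + (secondMoments w).2 =
      (secondMoments z).1 + (secondMoments z).2 := by
    simp only [secondMoments]
    rw [← integral_add, ← integral_add]
    · simp only [hnorm]
    all_goals exact integrable_uniformParams (by fun_prop)
  have hsub : (secondMoments w).1 - (secondMoments w).2 = 0 := by
    simp only [secondMoments]
    rw [← hsq, ← integral_sub]
    · simp only [hsplit]
    all_goals exact integrable_uniformParams (by fun_prop)
  ext <;> dsimp only <;> linarith

end UniformLaw

/-! ### Single-qubit operators -/

section Operators

variable {n : ℕ}

theorem tensor_mul (A B : Fin n → Matrix (Fin 2) (Fin 2) ℂ) :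
    tensor A * tensor B = tensor fun k => A k * B k := by
  ext x z
  simp only [tensor, mul_apply, of_apply, Finset.prod_univ_sum, Fintype.piFinset_univ,
    Finset.prod_mul_distrib]

theorem tensor_conjTranspose (A : Fin n → Matrix (Fin 2) (Fin 2) ℂ) :
    (tensor A)ᴴ = tensor fun k => (A k)ᴴ := by
  ext x y
  simp [tensor, conjTranspose_apply]

theorem onQubit_apply (q : Fin n) (A : Matrix (Fin 2) (Fin 2) ℂ) (x y : Fin n → Fin 2) :
    onQubit q A x y =
      A (x q) (y q) * ∏ k ∈ Finset.univ.erase q, (1 : Matrix (Fin 2) (Fin 2) ℂ) (x k) (y k) := by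
  simp only [onQubit, tensor, of_apply]
  rw [← Finset.mul_prod_erase _ _ (Finset.mem_univ q), Function.update_self]
  congr 1
  exact Finset.prod_congr rfl fun k hk => by rw [Function.update_of_ne (Finset.ne_of_mem_erase hk)]

/-- `onQubit q` as a homomorphism of star algebras. The scalars are real because only real
coefficients occur in the rotations `e^{-iθσ₂}`. -/
def onQubitHom (q : Fin n) : Matrix (Fin 2) (Fin 2) ℂ →⋆ₐ[ℝ] QMatrix n where
  toAlgHom := AlgHom.ofLinearMap
    { toFun := onQubit q
      map_add' := fun A B => by
        ext x y
        simp only [onQubit_apply, Matrix.add_apply, add_mul]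
      map_smul' := fun c A => by
        ext x y
        simp only [onQubit_apply, Matrix.smul_apply, smul_mul_assoc, RingHom.id_apply] }
    (by
      ext x y
      simp [onQubit, tensor, one_apply, Finset.prod_ite_zero, funext_iff])
    (fun A B => by
      simp only [LinearMap.coe_mk, AddHom.coe_mk, onQubit, tensor_mul]
      congr 1 with k : 1
      obtain rfl | h := eq_or_ne k q <;> simp [*])
  map_star' := fun A => by
    change onQubit q Aᴴ = (onQubit q A)ᴴ
    rw [onQubit, onQubit, tensor_conjTranspose]
    congr 1 with k : 1
    obtain rfl | h := eq_or_ne k q <;> simp [*]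

theorem onQubitHom_apply (q : Fin n) (A : Matrix (Fin 2) (Fin 2) ℂ) :
    onQubitHom q A = onQubit q A := rfl

theorem onQubit_commute {q r : Fin n} (h : q ≠ r) (A B : Matrix (Fin 2) (Fin 2) ℂ) :
    Commute (onQubit q A) (onQubit r B) := by
  rw [Commute, SemiconjBy, onQubit, onQubit, tensor_mul, tensor_mul]
  congr 1 with k : 1
  obtain rfl | hq := eq_or_ne k q
  · simp [h]
  · obtain rfl | hr := eq_or_ne k r <;> simp [*]

theorem firstPauli_eq_onQubit [NeZero n] (i : Fin 4) :
    firstPauli (n := n) i = onQubit 0 (pauli i) := by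
  rw [firstPauli, pauliString, onQubit]
  congr 1 with k : 1
  obtain rfl | h := eq_or_ne k 0 <;> simp [*, pauli]

theorem pauli_isHermitian (i : Fin 4) : (pauli i).IsHermitian := by
  ext j k
  fin_cases i <;> fin_cases j <;> fin_cases k <;> simp [pauli]

theorem pauli_mul_self (i : Fin 4) : pauli i * pauli i = 1 := by
  ext j k
  fin_cases i <;> fin_cases j <;> fin_cases k <;> simp [pauli]

theorem firstPauli_isHermitian [NeZero n] (i : Fin 4) : (firstPauli (n := n) i).IsHermitian := by
  rw [firstPauli_eq_onQubit, ← onQubitHom_apply]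
  exact (map_star _ _).symm.trans (congrArg _ (pauli_isHermitian i))

theorem firstPauli_mul_self [NeZero n] (i : Fin 4) :
    firstPauli (n := n) i * firstPauli i = 1 := by
  rw [firstPauli_eq_onQubit, ← onQubitHom_apply, ← map_mul, pauli_mul_self, map_one]

open scoped Matrix.Norms.Operator in
-- The real subalgebra generated by `J = -iσ₂` is a copy of `ℂ`, and `e^{θJ}` is the image of
-- `e^{iθ}`.
theorem rotY_eq (θ : ℝ) : rotY θ =
    !![(Real.cos θ : ℂ), -(Real.sin θ : ℂ); (Real.sin θ : ℂ), (Real.cos θ : ℂ)] := by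
  have hJ : (!![0, -1; 1, 0] : Matrix (Fin 2) (Fin 2) ℂ) * !![0, -1; 1, 0] = -1 := by
    ext i j
    fin_cases i <;> fin_cases j <;> simp
  let F : ℂ →ₐ[ℝ] Matrix (Fin 2) (Fin 2) ℂ := Complex.lift ⟨!![0, -1; 1, 0], hJ⟩
  have hF : ∀ z : ℂ, F z = !![(z.re : ℂ), -(z.im : ℂ); (z.im : ℂ), (z.re : ℂ)] := fun z => by
    ext i j
    fin_cases i <;> fin_cases j <;>
      simp [F, Complex.liftAux_apply, algebraMap_matrix_apply]
  have hexp := NormedSpace.map_exp F F.toLinearMap.continuous_of_finiteDimensional (θ * Complex.I)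
  rw [← Complex.exp_eq_exp_ℂ, hF, hF, Complex.exp_ofReal_mul_I_re, Complex.exp_ofReal_mul_I_im]
    at hexp
  rw [hexp, rotY]
  congr 1
  ext i j
  fin_cases i <;> fin_cases j <;> simp [pauli, mul_right_comm]

theorem rotY_add (θ t : ℝ) :
    rotY (θ + t) = Real.cos t • rotY θ + Real.sin t • rotY (θ + Real.pi / 2) := by
  simp only [rotY_eq, Real.cos_add_pi_div_two, Real.sin_add_pi_div_two]
  rw [Real.cos_add, Real.sin_add]
  ext i j
  fin_cases i <;> fin_cases j <;> simp <;> ring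

theorem rotY_mem_unitary (θ : ℝ) : rotY θ ∈ unitary (Matrix (Fin 2) (Fin 2) ℂ) := by
  refine exp_mem_unitaryGroup_of_conjTranspose_eq_neg ?_
  rw [conjTranspose_smul, (pauli_isHermitian 2).eq, ← neg_smul]
  simp

theorem rotY_conj_pauli_one (θ : ℝ) : (rotY θ)ᴴ * pauli 1 * rotY θ =
    Real.cos (2 * θ) • pauli 1 + Real.sin (2 * θ) • pauli 3 := by
  rw [rotY_eq, Real.cos_two_mul', Real.sin_two_mul]
  ext i j
  fin_cases i <;> fin_cases j <;>
    simp [pauli, mul_apply, conjTranspose_apply, Fin.sum_univ_two, -Complex.ofReal_cos,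
      -Complex.ofReal_sin] <;> ring

theorem rotY_conj_pauli_three (θ : ℝ) : (rotY θ)ᴴ * pauli 3 * rotY θ =
    Real.cos (2 * θ) • pauli 3 - Real.sin (2 * θ) • pauli 1 := by
  rw [rotY_eq, Real.cos_two_mul', Real.sin_two_mul]
  ext i j
  fin_cases i <;> fin_cases j <;>
    simp [pauli, mul_apply, conjTranspose_apply, Fin.sum_univ_two, -Complex.ofReal_cos,
      -Complex.ofReal_sin] <;> ring

theorem onQubit_rotY_add (q : Fin n) (θ t : ℝ) : onQubit q (rotY (θ + t)) =
    Real.cos t • onQubit q (rotY θ) + Real.sin t • onQubit q (rotY (θ + Real.pi / 2)) := by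
  rw [← onQubitHom_apply, rotY_add, map_add, map_smul, map_smul]
  rfl

open scoped Matrix.Norms.L2Operator in
theorem differentiable_onQubit_rotY (q : Fin n) : Differentiable ℝ fun t => onQubit q (rotY t) := by
  have hrot : (fun t => onQubit q (rotY t)) = fun t => Real.cos t • onQubit q (rotY 0) +
      Real.sin t • onQubit q (rotY (0 + Real.pi / 2)) :=
    funext fun t => by rw [← onQubit_rotY_add, zero_add]
  rw [hrot]
  fun_prop

end Operators

/-! ### Circuits and their parameters -/

section Circuits

variable {n : ℕ} {P : Type}

theorem cnotMatrix_mem_unitary {c t : Fin n} (h : c ≠ t) :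
    cnotMatrix c t ∈ unitary (QMatrix n) := by
  have hproj : IsStarProjection (!![0, 0; 0, 1] : Matrix (Fin 2) (Fin 2) ℂ) := by
    constructor <;> ext i j <;> fin_cases i <;> fin_cases j <;> simp
  have hflip : pauli 1 ∈ unitary (Matrix (Fin 2) (Fin 2) ℂ) :=
    mem_unitaryGroup_iff.2 ((congrArg _ (pauli_isHermitian 1)).trans (pauli_mul_self 1))
  have hcompl : (!![1, 0; 0, 0] : Matrix (Fin 2) (Fin 2) ℂ) = 1 - !![0, 0; 0, 1] := by
    ext i j
    fin_cases i <;> fin_cases j <;> simp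
  rw [cnotMatrix, hcompl]
  simp only [← onQubitHom_apply, map_sub, map_one]
  exact one_sub_add_mul_mem_unitary (hproj.map (onQubitHom c))
    (Unitary.map_mem (onQubitHom t) hflip) (onQubit_commute h _ _)

theorem commute_onQubit_cnotMatrix {c t q : Fin n} {A : Matrix (Fin 2) (Fin 2) ℂ} (hc : c ≠ q)
    (ht : Commute (onQubit q A) (onQubit t (pauli 1))) :
    Commute (onQubit q A) (cnotMatrix c t) :=
  (onQubit_commute hc.symm _ _).add_right ((onQubit_commute hc.symm _ _).mul_right ht)

theorem Gate.toMatrix_mem_unitary (θ : P → ℝ) : ∀ g : Gate n P, g.toMatrix θ ∈ unitary (QMatrix n)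
  | .ry p q => Unitary.map_mem (onQubitHom q) (rotY_mem_unitary (θ p))
  | .cnot _ _ h => cnotMatrix_mem_unitary h

theorem circuitMatrix_mem_unitary (θ : P → ℝ) :
    ∀ C : List (Gate n P), circuitMatrix θ C ∈ unitary (QMatrix n)
  | [] => one_mem _
  | g :: C => mul_mem (circuitMatrix_mem_unitary θ C) (g.toMatrix_mem_unitary θ)

theorem circuitMatrix_append (θ : P → ℝ) (C D : List (Gate n P)) :
    circuitMatrix θ (C ++ D) = circuitMatrix θ D * circuitMatrix θ C := by
  induction C with
  | nil => simp [circuitMatrix]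
  | cons g C ih => simp [circuitMatrix, ih, mul_assoc]

open scoped Matrix.Norms.L2Operator in
theorem differentiable_circuitMatrix [Finite P] (C : List (Gate n P)) :
    Differentiable ℝ fun θ : P → ℝ => circuitMatrix θ C := by
  have := Fintype.ofFinite P
  induction C with
  | nil => exact differentiable_const 1
  | cons g C ih =>
    refine ih.mul ?_
    cases g with
    | ry p q => exact (differentiable_onQubit_rotY q).comp (differentiable_apply p)
    | cnot c t h => exact differentiable_const _

/-- The parameter of a gate, if it has one. -/
def Gate.param : Gate n P → Option P
  | .ry p _ => some p
  | .cnot _ _ _ => none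

/-- The parameters of a circuit, in the order of the gates that they control. -/
def params (C : List (Gate n P)) : List P := C.filterMap Gate.param

theorem params_append (C D : List (Gate n P)) : params (C ++ D) = params C ++ params D :=
  List.filterMap_append ..

theorem params_cons_ry (p : P) (q : Fin n) (C : List (Gate n P)) :
    params (.ry p q :: C) = p :: params C := rfl

theorem exists_ry_mem_of_mem_params {C : List (Gate n P)} {p : P} (hp : p ∈ params C) :
    ∃ q, Gate.ry p q ∈ C := by
  obtain ⟨g, hg, hgp⟩ := List.mem_filterMap.1 hp
  cases g with
  | ry p' q => exact ⟨q, Option.some.inj hgp ▸ hg⟩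
  | cnot => cases hgp

theorem exists_append_cons_ry {C : List (Gate n P)} (hC : (params C).Nodup) {p : P} {q : Fin n}
    (h : Gate.ry p q ∈ C) :
    ∃ C₁ C₂, C = C₁ ++ Gate.ry p q :: C₂ ∧ p ∉ params C₁ ∧ p ∉ params C₂ := by
  obtain ⟨C₁, C₂, rfl⟩ := List.append_of_mem h
  rw [params_append, params_cons_ry, List.nodup_middle, List.nodup_cons, List.mem_append,
    not_or] at hC
  exact ⟨C₁, C₂, rfl, hC.1⟩

theorem circuitMatrix_dependsOn (C : List (Gate n P)) :
    DependsOn (fun θ : P → ℝ => circuitMatrix θ C) {p | p ∈ params C} := by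
  intro θ θ' h
  induction C with
  | nil => rfl
  | cons g C ih =>
    have hg : g.toMatrix θ = g.toMatrix θ' := by
      cases g with
      | ry p q => exact congrArg (onQubit q ∘ rotY) (h p (List.mem_cons_self ..))
      | cnot => rfl
    have hC : circuitMatrix θ C = circuitMatrix θ' C :=
      ih fun p hp => h p (((List.sublist_cons_self g C).filterMap _).subset hp)
    exact congrArg₂ (· * ·) hC hg

variable [DecidableEq P]

theorem apply_add_single_of_dependsOn {E : Type*} {F : (P → ℝ) → E} {p : P}
    (hF : DependsOn F {p}ᶜ) (θ : P → ℝ) (t : ℝ) : F (θ + Pi.single p t) = F θ :=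
  hF fun q hq => by simp [show q ≠ p from hq]

theorem circuitMatrix_add_single_of_notMem {C : List (Gate n P)} {p : P} (hp : p ∉ params C)
    (θ : P → ℝ) (t : ℝ) : circuitMatrix (θ + Pi.single p t) C = circuitMatrix θ C :=
  apply_add_single_of_dependsOn (F := fun θ : P → ℝ => circuitMatrix θ C)
    ((circuitMatrix_dependsOn C).mono (subset_compl_singleton_iff.2 hp)) θ t

theorem circuitMatrix_add_single_of_mem {C : List (Gate n P)} (hC : (params C).Nodup) {p : P}
    (hp : p ∈ params C) (θ : P → ℝ) (t : ℝ) :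
    circuitMatrix (θ + Pi.single p t) C = Real.cos t • circuitMatrix θ C +
      Real.sin t • circuitMatrix (θ + Pi.single p (Real.pi / 2)) C := by
  obtain ⟨q, hq⟩ := exists_ry_mem_of_mem_params hp
  obtain ⟨C₁, C₂, rfl, hC₁, hC₂⟩ := exists_append_cons_ry hC hq
  simp only [circuitMatrix_append, circuitMatrix, Gate.toMatrix,
    circuitMatrix_add_single_of_notMem hC₁, circuitMatrix_add_single_of_notMem hC₂, Pi.add_apply,
    Pi.single_eq_same]
  rw [onQubit_rotY_add]
  simp only [mul_add, add_mul, mul_smul_comm, smul_mul_assoc]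

end Circuits

/-! ### Evolution of states and of the Bloch vector of the first qubit -/

section Evolution

variable {n : ℕ} {P : Type}

/-- The operator `V(θ) σ(θ) V(θ)†` at the output of the circuit `C`. The input `σ` may itself
depend on the parameters, so that the output of one circuit can be the input of the next. -/
def evolve (C : List (Gate n P)) (σ : (P → ℝ) → QMatrix n) (θ : P → ℝ) : QMatrix n :=
  circuitMatrix θ C * σ θ * (circuitMatrix θ C)ᴴ

theorem evolve_append (C D : List (Gate n P)) (σ : (P → ℝ) → QMatrix n) :
    evolve (C ++ D) σ = evolve D (evolve C σ) := by
  funext θ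
  simp only [evolve, circuitMatrix_append, conjTranspose_mul, mul_assoc]

theorem evolve_singleton (g : Gate n P) (σ : (P → ℝ) → QMatrix n) (θ : P → ℝ) :
    evolve [g] σ θ = g.toMatrix θ * σ θ * (g.toMatrix θ)ᴴ := by
  simp only [evolve, circuitMatrix, one_mul]

theorem continuous_evolve [Finite P] (C : List (Gate n P)) {σ : (P → ℝ) → QMatrix n}
    (hσ : Continuous σ) : Continuous (evolve C σ) := by
  have := (differentiable_circuitMatrix C).continuous
  unfold evolve
  fun_prop

theorem dependsOn_evolve (C : List (Gate n P)) {σ : (P → ℝ) → QMatrix n} {s : Set P}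
    (hσ : DependsOn σ s) (hC : {p | p ∈ params C} ⊆ s) : DependsOn (evolve C σ) s :=
  fun _ _ h => by simp only [evolve, (circuitMatrix_dependsOn C).mono hC h, hσ h]

theorem isState_evolve (C : List (Gate n P)) {ρ : QMatrix n} (hρ : IsState ρ) (θ : P → ℝ) :
    IsState (evolve C (fun _ => ρ) θ) := by
  refine ⟨hρ.1.mul_mul_conjTranspose_same _, ?_⟩
  rw [evolve, trace_mul_cycle, ← star_eq_conjTranspose,
    Unitary.star_mul_self_of_mem (circuitMatrix_mem_unitary θ C), one_mul, hρ.2]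

theorem exists_evolve_add_single_eq [DecidableEq P] {C : List (Gate n P)} (hC : (params C).Nodup)
    (ρ : QMatrix n) (p : P) (θ : P → ℝ) :
    ∃ A B D : QMatrix n, ∀ t, evolve C (fun _ => ρ) (θ + Pi.single p t) =
      A + Real.cos (2 * t) • B + Real.sin (2 * t) • D := by
  by_cases hp : p ∈ params C
  · set V := circuitMatrix θ C
    set W := circuitMatrix (θ + Pi.single p (Real.pi / 2)) C
    refine ⟨(1 / 2 : ℝ) • (V * ρ * Vᴴ + W * ρ * Wᴴ), (1 / 2 : ℝ) • (V * ρ * Vᴴ - W * ρ * Wᴴ),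
      (1 / 2 : ℝ) • (V * ρ * Wᴴ + W * ρ * Vᴴ), fun t => ?_⟩
    rw [evolve, circuitMatrix_add_single_of_mem hC hp, Real.cos_two_mul', Real.sin_two_mul]
    simp only [conjTranspose_add, conjTranspose_smul, star_trivial, add_mul, mul_add,
      mul_smul_comm, smul_mul_assoc]
    match_scalars <;> first | ring1 | linear_combination (1 / 2 : ℝ) * Real.cos_sq_add_sin_sq t
  · refine ⟨evolve C (fun _ => ρ) θ, 0, 0, fun t => ?_⟩
    simp only [evolve, circuitMatrix_add_single_of_notMem hp, smul_zero, add_zero]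

theorem trace_mul_conj_of_commute {A U : QMatrix n} (hU : U ∈ unitary (QMatrix n))
    (h : Commute A U) (σ : QMatrix n) : (A * (U * σ * Uᴴ)).trace = (A * σ).trace := by
  rw [← mul_assoc, ← mul_assoc, h.eq, trace_mul_comm, ← mul_assoc, ← mul_assoc,
    ← star_eq_conjTranspose, Unitary.star_mul_self_of_mem hU, one_mul]

variable [NeZero n]

/-- The Bloch vector `(Re Tr[σ₁ σ], Re Tr[σ₃ σ])` of the first qubit in the `X`-`Z` plane, as a
complex number. -/
def bloch : QMatrix n →ₗ[ℝ] ℂ where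
  toFun σ := ⟨(firstPauli 1 * σ).trace.re, (firstPauli 3 * σ).trace.re⟩
  map_add' σ τ := by
    apply Complex.ext <;> simp [mul_add]
  map_smul' c σ := by
    apply Complex.ext <;> simp

theorem bloch_eq (σ : QMatrix n) :
    bloch σ = ⟨(firstPauli 1 * σ).trace.re, (firstPauli 3 * σ).trace.re⟩ := rfl

theorem abs_im_bloch_le {ρ : QMatrix n} (hρ : IsState ρ) : |(bloch ρ).im| ≤ 1 := by
  have h := abs_re_trace_mul_le (firstPauli_isHermitian 3) (firstPauli_mul_self 3) hρ.1
  rwa [hρ.2, RCLike.one_re] at h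

theorem alpha_eq (ρ : QMatrix n) : alpha ρ = (bloch ρ).re ^ 2 + (bloch ρ).im ^ 2 := rfl

theorem objective_eq (C : List (Gate n P)) (ρ : QMatrix n) (θ : P → ℝ) :
    objective C ρ (WithLp.toLp 2 θ) = 1 / 2 + 1 / 2 * (bloch (evolve C (fun _ => ρ) θ)).im := by
  simp only [objective, bloch_eq, evolve, mul_assoc]

open scoped Matrix.Norms.L2Operator in
theorem differentiable_objective [Finite P] (C : List (Gate n P)) (ρ : QMatrix n) :
    Differentiable ℝ (objective C ρ) := by
  have := Fintype.ofFinite P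
  have hV := differentiable_circuitMatrix C
  have hbloch : Differentiable ℝ fun θ => bloch (evolve C (fun _ => ρ) θ) :=
    bloch.toContinuousLinearMap.differentiable.comp ((hV.mul_const ρ).mul hV.star)
  have him := Complex.imCLM.differentiable.comp
    (hbloch.comp (PiLp.continuousLinearEquiv 2 ℝ fun _ : P => ℝ).differentiable)
  rw [show objective C ρ = _ from funext fun θ => objective_eq C ρ θ]
  exact (him.const_mul _).const_add _

theorem bloch_rotY_conj (t : ℝ) (σ : QMatrix n) :
    bloch (onQubit 0 (rotY t) * σ * (onQubit 0 (rotY t))ᴴ) =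
      Complex.exp (-2 * Complex.I * t) * bloch σ := by
  have hpauli : ∀ i : Fin 4,
      (firstPauli i * (onQubit 0 (rotY t) * σ * (onQubit 0 (rotY t))ᴴ)).trace =
        (onQubitHom 0 ((rotY t)ᴴ * pauli i * rotY t) * σ).trace := fun i => by
    rw [map_mul, map_mul, ← star_eq_conjTranspose, ← star_eq_conjTranspose, map_star,
      firstPauli_eq_onQubit, ← mul_assoc, trace_mul_comm]
    simp only [onQubitHom_apply, mul_assoc]
  have hexp : Complex.exp (-2 * Complex.I * t) =
      ⟨Real.cos (2 * t), -Real.sin (2 * t)⟩ := by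
    rw [show -2 * Complex.I * t = ((-(2 * t) : ℝ) : ℂ) * Complex.I by push_cast; ring]
    apply Complex.ext <;>
      simp only [Complex.exp_ofReal_mul_I_re, Complex.exp_ofReal_mul_I_im, Real.cos_neg,
        Real.sin_neg]
  rw [bloch_eq, bloch_eq, hpauli, hpauli, rotY_conj_pauli_one, rotY_conj_pauli_three, hexp]
  simp only [map_add, map_sub, map_smul, onQubitHom_apply, ← firstPauli_eq_onQubit, add_mul,
    sub_mul, smul_mul_assoc, trace_add, trace_sub, trace_smul, Complex.add_re, Complex.sub_re,
    Complex.smul_re, smul_eq_mul]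
  apply Complex.ext <;> simp only [Complex.mul_re, Complex.mul_im] <;> ring

end Evolution

/-! ### The parameter-shift rule -/

section ParameterShift

variable {n : ℕ} {P : Type} [DecidableEq P]

/-- The central difference of `F` in the coordinate `p`, with step `π / 4`. It is half of the
partial derivative if `F` is a combination of `1`, `cos (2 * θ p)` and `sin (2 * θ p)`. -/
def centralDiff {E : Type*} [AddCommGroup E] [Module ℝ E] (p : P) (F : (P → ℝ) → E)
    (θ : P → ℝ) : E :=
  (1 / 2 : ℝ) • (F (θ + Pi.single p (Real.pi / 4)) - F (θ + Pi.single p (-(Real.pi / 4))))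

theorem map_centralDiff {E E' : Type*} [AddCommGroup E] [Module ℝ E] [AddCommGroup E']
    [Module ℝ E'] (φ : E →ₗ[ℝ] E') (p : P) (F : (P → ℝ) → E) (θ : P → ℝ) :
    φ (centralDiff p F θ) = centralDiff p (fun θ => φ (F θ)) θ := by
  simp only [centralDiff, map_smul, map_sub]

theorem dependsOn_centralDiff {E : Type*} [AddCommGroup E] [Module ℝ E] (p : P)
    {F : (P → ℝ) → E} {s : Set P} (hF : DependsOn F s) : DependsOn (centralDiff p F) s := by
  intro θ θ' h
  have hshift : ∀ t : ℝ, F (θ + Pi.single p t) = F (θ' + Pi.single p t) := fun t =>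
    hF fun q hq => by simp only [Pi.add_apply, h q hq]
  simp only [centralDiff, hshift]

theorem continuous_centralDiff [Finite P] {E : Type*} [AddCommGroup E] [Module ℝ E]
    [TopologicalSpace E] [IsTopologicalAddGroup E] [ContinuousConstSMul ℝ E] (p : P)
    {F : (P → ℝ) → E} (hF : Continuous F) : Continuous (centralDiff p F) := by
  unfold centralDiff
  fun_prop

theorem centralDiff_exp_mul {p : P} {z : (P → ℝ) → ℂ} (hzp : DependsOn z {p}ᶜ) (θ : P → ℝ) :
    centralDiff p (fun θ => Complex.exp (-2 * Complex.I * θ p) * z θ) θ =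
      -Complex.I * (Complex.exp (-2 * Complex.I * θ p) * z θ) := by
  have hexp : ∀ t : ℝ, Complex.exp (-2 * Complex.I * ((θ p + t : ℝ) : ℂ)) =
      Complex.exp (-2 * Complex.I * θ p) * Complex.exp (((-(2 * t) : ℝ) : ℂ) * Complex.I) :=
    fun t => by
      rw [← Complex.exp_add]
      push_cast
      ring_nf
  simp only [centralDiff, apply_add_single_of_dependsOn hzp, Pi.add_apply, Pi.single_eq_same, hexp]
  rw [show -(2 * (Real.pi / 4)) = -(Real.pi / 2) by ring,
    show -(2 * -(Real.pi / 4)) = Real.pi / 2 by ring]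
  rw [Complex.real_smul]
  push_cast
  rw [← neg_div, Complex.exp_neg_pi_div_two_mul_I, Complex.exp_pi_div_two_mul_I]
  ring

theorem evolve_centralDiff {C : List (Gate n P)} {p : P} (hp : p ∉ params C)
    (σ : (P → ℝ) → QMatrix n) : evolve C (centralDiff p σ) = centralDiff p (evolve C σ) := by
  funext θ
  simp only [evolve, centralDiff, circuitMatrix_add_single_of_notMem hp, mul_sub, sub_mul,
    mul_smul_comm, smul_mul_assoc]

variable [NeZero n]

theorem abs_im_bloch_centralDiff_evolve_le (C : List (Gate n P)) {ρ : QMatrix n} (hρ : IsState ρ)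
    (p : P) (θ : P → ℝ) : |(bloch (centralDiff p (evolve C fun _ => ρ) θ)).im| ≤ 1 := by
  have h := fun t : ℝ => abs_le.1 (abs_im_bloch_le (isState_evolve C hρ (θ + Pi.single p t)))
  rw [map_centralDiff, centralDiff, Complex.smul_im, Complex.sub_im, smul_eq_mul, abs_le]
  constructor <;> linarith [h (Real.pi / 4), h (-(Real.pi / 4))]

variable [Fintype P]

theorem gradient_objective_apply {C : List (Gate n P)} (hC : (params C).Nodup) (ρ : QMatrix n)
    (θ : P → ℝ) (p : P) : gradient (objective C ρ) (WithLp.toLp 2 θ) p =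
      (bloch (centralDiff p (evolve C fun _ => ρ) θ)).im := by
  obtain ⟨A, B, D, hABD⟩ := exists_evolve_add_single_eq hC ρ p θ
  have hline : ∀ t : ℝ, objective C ρ (WithLp.toLp 2 θ + t • EuclideanSpace.single p 1) =
      1 / 2 + 1 / 2 * (bloch (evolve C (fun _ => ρ) (θ + Pi.single p t))).im := fun t => by
    rw [← objective_eq, WithLp.toLp_add]
    congr
    ext q
    simp [Pi.single_apply]
  have hderiv := hasDerivAt_of_eq_cos_add_sin
    (F := fun t => objective C ρ (WithLp.toLp 2 θ + t • EuclideanSpace.single p 1))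
    (a := 1 / 2 + 1 / 2 * (bloch A).im) (b := 1 / 2 * (bloch B).im)
    (c := 1 / 2 * (bloch D).im) fun t => by
      rw [hline t, hABD]
      simp only [map_add, map_smul, Complex.add_im, Complex.smul_im, smul_eq_mul]
      ring
  rw [(hasDerivAt_add_smul_single_gradient (differentiable_objective C ρ _) p).unique hderiv,
    hline, hline, map_centralDiff, centralDiff, Complex.smul_im, Complex.sub_im, smul_eq_mul]
  ring

theorem sqGradNorm_objective {C : List (Gate n P)} (hC : (params C).Nodup) (ρ : QMatrix n) :
    sqGradNorm (objective C ρ) =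
      fun θ => ∑ p, (bloch (centralDiff p (evolve C fun _ => ρ) θ)).im ^ 2 := by
  funext θ
  simp only [sqGradNorm, EuclideanSpace.norm_sq_eq, gradient_objective_apply hC, Real.norm_eq_abs,
    sq_abs]

end ParameterShift

/-! ### Second moments along a circuit -/

section SecondMoments

variable {n : ℕ} [NeZero n] {P : Type}

/-- The effect of a gate on lower bounds for the second moments of the two components of the Bloch
vector of the first qubit. A CNOT with the first qubit as its target forgets the `Z` component. -/
def momentStep (v : ℝ × ℝ) : Gate n P → ℝ × ℝ
  | .ry _ q => if q = 0 then ((v.1 + v.2) / 2, (v.1 + v.2) / 2) else v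
  | .cnot _ t _ => if t = 0 then (v.1, 0) else v

/-- The gate is not a CNOT controlled by the first qubit. -/
def Gate.FirstNotControl : Gate n P → Prop
  | .ry _ _ => True
  | .cnot c _ _ => c ≠ 0

theorem monotone_momentStep (g : Gate n P) : Monotone (momentStep · g) := by
  rintro v w ⟨h₁, h₂⟩
  have havg : (v.1 + v.2) / 2 ≤ (w.1 + w.2) / 2 := by gcongr
  cases g with
  | ry p q =>
    by_cases hq : q = 0
    · simpa only [momentStep, if_pos hq] using ⟨havg, havg⟩
    · simpa only [momentStep, if_neg hq] using ⟨h₁, h₂⟩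
  | cnot c t h =>
    by_cases ht : t = 0
    · simpa only [momentStep, if_pos ht] using ⟨h₁, le_rfl⟩
    · simpa only [momentStep, if_neg ht] using ⟨h₁, h₂⟩

theorem bloch_evolve_ry_zero (p : P) (σ : (P → ℝ) → QMatrix n) (θ : P → ℝ) :
    bloch (evolve [.ry p 0] σ θ) = Complex.exp (-2 * Complex.I * θ p) * bloch (σ θ) := by
  rw [evolve_singleton, Gate.toMatrix, bloch_rotY_conj]

theorem bloch_evolve_of_commute {g : Gate n P} {θ : P → ℝ}
    (h : ∀ i, Commute (firstPauli i) (g.toMatrix θ)) (σ : (P → ℝ) → QMatrix n) :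
    bloch (evolve [g] σ θ) = bloch (σ θ) := by
  simp only [evolve_singleton, bloch_eq,
    trace_mul_conj_of_commute (g.toMatrix_mem_unitary θ) (h _)]

theorem bloch_evolve_cnot_zero_re {c : Fin n} (h : c ≠ 0) (σ : (P → ℝ) → QMatrix n) (θ : P → ℝ) :
    (bloch (evolve [.cnot c 0 h] σ θ)).re = (bloch (σ θ)).re := by
  have hcomm : Commute (firstPauli 1) (cnotMatrix c 0) := by
    rw [firstPauli_eq_onQubit]
    exact commute_onQubit_cnotMatrix h (Commute.refl _)
  rw [evolve_singleton]
  exact congrArg Complex.re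
    (a₁ := (firstPauli 1 * (cnotMatrix c 0 * σ θ * (cnotMatrix c 0)ᴴ)).trace)
    (trace_mul_conj_of_commute (cnotMatrix_mem_unitary h) hcomm (σ θ))

theorem continuous_bloch : Continuous (bloch : QMatrix n → ℂ) :=
  bloch.continuous_of_finiteDimensional

theorem continuous_im_bloch_centralDiff_evolve_sq [Finite P] [DecidableEq P]
    (C : List (Gate n P)) (ρ : QMatrix n) (p : P) :
    Continuous fun θ => (bloch (centralDiff p (evolve C fun _ => ρ) θ)).im ^ 2 :=
  (Complex.continuous_im.comp (continuous_bloch.comp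
    (continuous_centralDiff p (continuous_evolve C continuous_const)))).pow 2

variable [Fintype P]

theorem momentStep_secondMoments_le {g : Gate n P} (hg : g.FirstNotControl)
    {σ : (P → ℝ) → QMatrix n} (hσ : Continuous σ) (hσg : DependsOn σ {p | p ∈ params [g]}ᶜ) :
    momentStep (secondMoments (bloch ∘ σ)) g ≤ secondMoments (bloch ∘ evolve [g] σ) := by
  have hidle : (∀ i θ, Commute (firstPauli i) (g.toMatrix θ)) →
      secondMoments (bloch ∘ σ) ≤ secondMoments (bloch ∘ evolve [g] σ) := fun h =>
    le_of_eq (congrArg secondMoments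
      (funext fun θ => (bloch_evolve_of_commute (fun i => h i θ) σ).symm))
  simp only [firstPauli_eq_onQubit] at hidle
  cases g with
  | ry p q =>
    by_cases hq : q = 0
    · subst hq
      have hσp : DependsOn (bloch ∘ σ) {p}ᶜ := fun _ _ h =>
        congrArg bloch (hσg fun q hq => h q fun hqp => hq (List.mem_singleton.2 hqp))
      rw [momentStep, if_pos rfl, ← secondMoments_exp_mul (continuous_bloch.comp hσ) hσp]
      exact le_of_eq (congrArg secondMoments
        (funext fun θ => (bloch_evolve_ry_zero p σ θ).symm))
    · rw [momentStep, if_neg hq]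
      exact hidle fun _ _ => onQubit_commute (Ne.symm hq) _ _
  | cnot c t h =>
    by_cases ht : t = 0
    · subst ht
      rw [momentStep, if_pos rfl]
      refine ⟨le_of_eq ?_, integral_nonneg fun _ => sq_nonneg _⟩
      simp only [secondMoments, Function.comp_apply, bloch_evolve_cnot_zero_re]
    · rw [momentStep, if_neg ht]
      exact hidle fun _ _ => commute_onQubit_cnotMatrix hg (onQubit_commute (Ne.symm ht) _ _)

theorem foldl_momentStep_secondMoments_le {C : List (Gate n P)} (hC : (params C).Nodup)
    (hctrl : ∀ g ∈ C, g.FirstNotControl) {σ : (P → ℝ) → QMatrix n} (hσ : Continuous σ)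
    (hσC : DependsOn σ {p | p ∈ params C}ᶜ) :
    C.foldl momentStep (secondMoments (bloch ∘ σ)) ≤ secondMoments (bloch ∘ evolve C σ) := by
  induction C generalizing σ with
  | nil =>
    have hnil : evolve [] σ = σ := by
      funext θ
      simp [evolve, circuitMatrix]
    rw [hnil, List.foldl_nil]
  | cons g C ih =>
    have happ : params (g :: C) = params [g] ++ params C := params_append [g] C
    rw [happ, List.nodup_append'] at hC
    simp only [happ, List.mem_append] at hσC
    rw [List.forall_mem_cons] at hctrl
    have hstep := momentStep_secondMoments_le hctrl.1 hσ
      (hσC.mono (compl_subset_compl.2 fun p hp => Or.inl hp))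
    have hdep : DependsOn (evolve [g] σ) {p | p ∈ params C}ᶜ :=
      dependsOn_evolve [g] (hσC.mono (compl_subset_compl.2 fun p hp => Or.inr hp)) hC.2.2
    rw [List.foldl_cons, ← List.singleton_append, evolve_append]
    exact (List.foldl_monotone monotone_momentStep C hstep).trans
      (ih hC.2.1 hctrl.2 (continuous_evolve [g] hσ) hdep)

theorem secondMoments_bloch_centralDiff_ry_zero [DecidableEq P] {p : P} {σ : (P → ℝ) → QMatrix n}
    (hσ : Continuous σ) (hσp : DependsOn σ {p}ᶜ) :
    secondMoments (bloch ∘ centralDiff p (evolve [.ry p 0] σ)) =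
      secondMoments (bloch ∘ evolve [.ry p 0] σ) := by
  have hz : Continuous (bloch ∘ σ) := continuous_bloch.comp hσ
  have hzp : DependsOn (bloch ∘ σ) {p}ᶜ := fun _ _ h => congrArg bloch (hσp h)
  have hdiff : bloch ∘ centralDiff p (evolve [.ry p 0] σ) =
      fun θ => -Complex.I * (Complex.exp (-2 * Complex.I * θ p) * (bloch ∘ σ) θ) := by
    funext θ
    simp only [Function.comp_apply, map_centralDiff, bloch_evolve_ry_zero]
    exact centralDiff_exp_mul hzp θ
  rw [hdiff, secondMoments_neg_I_mul, secondMoments_exp_mul hz hzp, Prod.swap_prod_mk,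
    ← secondMoments_exp_mul hz hzp]
  exact congrArg secondMoments (funext fun θ => (bloch_evolve_ry_zero p σ θ).symm)

theorem foldl_momentStep_le_centralDiff [DecidableEq P] {C : List (Gate n P)}
    (hC : (params C).Nodup) (hctrl : ∀ g ∈ C, g.FirstNotControl) (ρ : QMatrix n) {p : P}
    (hp : Gate.ry p 0 ∈ C) :
    C.foldl momentStep ((bloch ρ).re ^ 2, (bloch ρ).im ^ 2) ≤
      secondMoments (bloch ∘ centralDiff p (evolve C fun _ => ρ)) := by
  obtain ⟨C₁, C₂, rfl, hp₁, hp₂⟩ := exists_append_cons_ry hC hp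
  have hsplit : C₁ ++ Gate.ry p 0 :: C₂ = (C₁ ++ [Gate.ry p 0]) ++ C₂ := by simp
  rw [hsplit] at hC hctrl ⊢
  rw [params_append, List.nodup_append'] at hC
  rw [List.forall_mem_append] at hctrl
  set σ : (P → ℝ) → QMatrix n := evolve (C₁ ++ [.ry p 0]) fun _ => ρ
  have hconst : ∀ s : Set P, DependsOn (fun _ : P → ℝ => ρ) s := fun s _ _ _ => rfl
  have hσ : Continuous σ := continuous_evolve _ continuous_const
  have hσC : DependsOn σ {p | p ∈ params C₂}ᶜ := dependsOn_evolve _ (hconst _) hC.2.2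
  have hbefore : (C₁ ++ [Gate.ry p 0]).foldl momentStep ((bloch ρ).re ^ 2, (bloch ρ).im ^ 2) ≤
      secondMoments (bloch ∘ σ) := by
    rw [← secondMoments_const (P := P)]
    exact foldl_momentStep_secondMoments_le hC.1 hctrl.1 continuous_const (hconst _)
  have hdiff : secondMoments (bloch ∘ centralDiff p σ) = secondMoments (bloch ∘ σ) := by
    simp only [σ, evolve_append]
    exact secondMoments_bloch_centralDiff_ry_zero (continuous_evolve C₁ continuous_const)
      (dependsOn_evolve C₁ (hconst _) (subset_compl_singleton_iff.2 hp₁))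
  rw [List.foldl_append, evolve_append, ← evolve_centralDiff hp₂]
  refine (List.foldl_monotone monotone_momentStep C₂ (hbefore.trans hdiff.ge)).trans ?_
  exact foldl_momentStep_secondMoments_le hC.2.1 hctrl.2 (continuous_centralDiff p hσ)
    (dependsOn_centralDiff p hσC)

theorem integrable_sqGradNorm_objective {C : List (Gate n P)} (hC : (params C).Nodup)
    (ρ : QMatrix n) : Integrable (sqGradNorm (objective C ρ)) (uniformParams P) := by
  classical
  rw [sqGradNorm_objective hC]
  exact integrable_uniformParams
    (continuous_finsetSum _ fun p _ => continuous_im_bloch_centralDiff_evolve_sq C ρ p)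

theorem integral_sqGradNorm_objective_le {C : List (Gate n P)} (hC : (params C).Nodup)
    {ρ : QMatrix n} (hρ : IsState ρ) :
    ∫ θ, sqGradNorm (objective C ρ) θ ∂uniformParams P ≤ Fintype.card P := by
  classical
  have hle : ∀ θ, sqGradNorm (objective C ρ) θ ≤ Fintype.card P := fun θ => by
    rw [sqGradNorm_objective hC, Fintype.card, Finset.cast_card]
    exact Finset.sum_le_sum fun p _ =>
      (sq_le_one_iff_abs_le_one _).2 (abs_im_bloch_centralDiff_evolve_le C hρ p θ)
  simpa using integral_mono (integrable_sqGradNorm_objective hC ρ) (integrable_const _) hle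

theorem le_integral_sqGradNorm_objective {C : List (Gate n P)} (hC : (params C).Nodup)
    (hctrl : ∀ g ∈ C, g.FirstNotControl) (ρ : QMatrix n) {S : Finset P}
    (hS : ∀ p ∈ S, Gate.ry p 0 ∈ C) :
    S.card * (C.foldl momentStep ((bloch ρ).re ^ 2, (bloch ρ).im ^ 2)).2 ≤
      ∫ θ, sqGradNorm (objective C ρ) θ ∂uniformParams P := by
  classical
  rw [sqGradNorm_objective hC, integral_finsetSum _ fun p _ => integrable_uniformParams
    (continuous_im_bloch_centralDiff_evolve_sq C ρ p), ← nsmul_eq_mul]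
  refine (Finset.card_nsmul_le_sum S _ _ fun p hp =>
    (foldl_momentStep_le_centralDiff hC hctrl ρ (hS p hp)).2).trans ?_
  exact Finset.sum_le_sum_of_subset_of_nonneg (Finset.subset_univ S) fun p _ _ =>
    integral_nonneg fun θ => sq_nonneg _

end SecondMoments

/-! ### Second moments along layers of gates -/

section Layers

theorem foldl_momentStep_ofFn {n : ℕ} [NeZero n] {P : Type} {N : ℕ} [NeZero N]
    {f : Fin N → Gate n P} (hf : ∀ j ≠ 0, ∀ v, momentStep v (f j) = v) (v : ℝ × ℝ) :
    (List.ofFn f).foldl momentStep v = momentStep v (f 0) := by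
  obtain ⟨M, rfl⟩ := Nat.exists_eq_succ_of_ne_zero (NeZero.ne N)
  rw [List.ofFn_succ, List.foldl_cons, List.ofFn_eq_map, List.foldl_map,
    List.foldl_fixed' fun j => hf j.succ (Fin.succ_ne_zero j) _]

theorem foldl_eq_div_two_pow_countP {ι : Type*} {F : ℝ × ℝ → ι → ℝ × ℝ} {p : ι → Prop}
    [DecidablePred p] (hF : ∀ a i, F (a, a) i = if p i then (a / 2, a / 2) else (a, a))
    (L : List ι) (a : ℝ) :
    L.foldl F (a, a) = (a / 2 ^ L.countP p, a / 2 ^ L.countP p) := by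
  induction L generalizing a with
  | nil => simp
  | cons i L ih =>
    rw [List.foldl_cons, hF]
    by_cases hi : p i
    · rw [if_pos hi, ih, List.countP_cons_of_pos (by simpa using hi), pow_succ', div_div]
    · rw [if_neg hi, ih, List.countP_cons_of_neg (by simpa using hi)]

end Layers

/-! ### The tree-tensor circuit -/

section TreeTensor

variable {n m : ℕ}

theorem params_ttRotLayer (hn : n = 2 ^ m) (ℓ : Fin (m + 1)) : params (ttRotLayer hn ℓ) =
    List.ofFn fun j : Fin (2 ^ (m - (ℓ : ℕ))) => (⟨ℓ, j⟩ : TTParam m) := by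
  rw [params, ttRotLayer, List.ofFn_eq_map, List.ofFn_eq_map, List.filterMap_map,
    ← List.filterMap_eq_map]
  rfl

theorem params_ttCnotLayer (hn : n = 2 ^ m) (ℓ : Fin m) : params (ttCnotLayer hn ℓ) = [] := by
  rw [params, List.filterMap_eq_nil_iff, ttCnotLayer, List.forall_mem_ofFn_iff]
  exact fun _ => rfl

theorem params_ttCircuit (hn : n = 2 ^ m) : params (ttCircuit hn) =
    (List.finRange (m + 1)).flatMap fun ℓ : Fin (m + 1) =>
      List.ofFn fun j : Fin (2 ^ (m - (ℓ : ℕ))) => (⟨ℓ, j⟩ : TTParam m) := by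
  have hlayers : ∀ ℓ : Fin m, params (ttCnotLayer hn ℓ ++ ttRotLayer hn ℓ.succ) =
      params (ttRotLayer hn ℓ.succ) := fun ℓ => by
    rw [params_append, params_ttCnotLayer, List.nil_append]
  rw [ttCircuit, params_append, List.finRange_succ, List.flatMap_cons, List.flatMap_map,
    params_ttRotLayer, params, List.filterMap_flatMap]
  exact congrArg _ (List.flatMap_congr fun ℓ _ => (hlayers ℓ).trans (params_ttRotLayer hn ℓ.succ))

theorem nodup_params_ttCircuit (hn : n = 2 ^ m) : (params (ttCircuit hn)).Nodup := by
  rw [params_ttCircuit, List.nodup_flatMap]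
  refine ⟨fun ℓ _ => List.nodup_ofFn.2 fun i j h => eq_of_heq (Sigma.mk.inj h).2,
    (List.nodup_finRange (m + 1)).imp fun {ℓ k} hne x hx hx' => hne ?_⟩
  obtain ⟨i, rfl⟩ := List.mem_ofFn.1 hx
  obtain ⟨j, hj⟩ := List.mem_ofFn.1 hx'
  exact (congrArg Sigma.fst hj).symm

theorem ttRotLayer_subset_ttCircuit (hn : n = 2 ^ m) (ℓ : Fin (m + 1)) :
    ttRotLayer hn ℓ ⊆ ttCircuit hn := by
  intro g hg
  rw [ttCircuit, List.mem_append, List.mem_flatMap]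
  cases ℓ using Fin.cases with
  | zero => exact Or.inl hg
  | succ ℓ => exact Or.inr ⟨ℓ, List.mem_finRange ℓ, List.mem_append_right _ hg⟩

theorem card_ttParam (m : ℕ) : (Fintype.card (TTParam m) : ℝ) = 2 * 2 ^ m - 1 := by
  have hsum : Fintype.card (TTParam m) = ∑ ℓ ∈ Finset.range (m + 1), 2 ^ ℓ := by
    rw [Fintype.card_sigma, ← Finset.sum_range_reflect, Finset.sum_range]
    simp
  rw [hsum, Nat.cast_sum]
  push_cast
  rw [geom_sum_eq (by norm_num)]
  ring

variable [NeZero n]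

theorem ttCircuit_firstNotControl (hn : n = 2 ^ m) :
    ∀ g ∈ ttCircuit hn, g.FirstNotControl := by
  have hrot : ∀ ℓ, ∀ g ∈ ttRotLayer hn ℓ, g.FirstNotControl := fun ℓ =>
    List.forall_mem_ofFn_iff.2 fun _ => trivial
  have hcnot : ∀ ℓ, ∀ g ∈ ttCnotLayer hn ℓ, g.FirstNotControl := fun ℓ =>
    List.forall_mem_ofFn_iff.2 fun j => by simp [Gate.FirstNotControl]
  rw [ttCircuit, List.forall_mem_append, List.forall_mem_flatMap]
  exact ⟨hrot 0, fun ℓ _ => List.forall_mem_append.2 ⟨hcnot ℓ, hrot ℓ.succ⟩⟩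

theorem foldl_momentStep_ttRotLayer (hn : n = 2 ^ m) (ℓ : Fin (m + 1)) (v : ℝ × ℝ) :
    (ttRotLayer hn ℓ).foldl momentStep v = ((v.1 + v.2) / 2, (v.1 + v.2) / 2) := by
  rw [ttRotLayer, foldl_momentStep_ofFn]
  · simp [momentStep]
  · intro j hj v
    simp [momentStep, hj]

theorem foldl_momentStep_ttCnotLayer (hn : n = 2 ^ m) (ℓ : Fin m) (v : ℝ × ℝ) :
    (ttCnotLayer hn ℓ).foldl momentStep v = (v.1, 0) := by
  rw [ttCnotLayer, foldl_momentStep_ofFn]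
  · simp [momentStep]
  · intro j hj v
    simp [momentStep, hj]

theorem foldl_momentStep_ttCircuit (hn : n = 2 ^ m) (v : ℝ × ℝ) :
    (ttCircuit hn).foldl momentStep v =
      ((v.1 + v.2) / 2 / 2 ^ m, (v.1 + v.2) / 2 / 2 ^ m) := by
  rw [ttCircuit, List.foldl_append, foldl_momentStep_ttRotLayer, List.foldl_flatMap,
    foldl_eq_div_two_pow_countP (p := fun _ => True)]
  · simp
  · intro a ℓ
    rw [List.foldl_append, foldl_momentStep_ttCnotLayer, foldl_momentStep_ttRotLayer]
    simp

theorem le_integral_sqGradNorm_ttCircuit (hn : n = 2 ^ m) (ρ : QMatrix n) :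
    (1 + Real.logb 2 n) / (2 * n) * alpha ρ ≤
      ∫ θ, sqGradNorm (objective (ttCircuit hn) ρ) θ ∂uniformParams (TTParam m) := by
  let firstOfLayer : Fin (m + 1) ↪ TTParam m :=
    ⟨fun ℓ => ⟨ℓ, 0⟩, fun _ _ h => congrArg Sigma.fst h⟩
  have hmem : ∀ p ∈ Finset.univ.map firstOfLayer, Gate.ry p 0 ∈ ttCircuit hn := by
    simp only [Finset.mem_map, Finset.mem_univ, true_and, forall_exists_index,
      forall_apply_eq_imp_iff]
    exact fun ℓ => ttRotLayer_subset_ttCircuit hn ℓ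
      (List.mem_ofFn.2 ⟨0, congrArg (Gate.ry _) (Fin.ext (Nat.zero_mul _))⟩)
  have hbound := le_integral_sqGradNorm_objective (nodup_params_ttCircuit hn)
    (ttCircuit_firstNotControl hn) ρ hmem
  rw [foldl_momentStep_ttCircuit, ← alpha_eq, Finset.card_map, Finset.card_fin] at hbound
  have hn' : (n : ℝ) = 2 ^ m := by exact_mod_cast hn
  refine le_of_eq_of_le ?_ hbound
  rw [hn', Real.logb_pow, Real.logb_self_eq_one one_lt_two]
  push_cast
  field_simp
  ring

theorem integral_sqGradNorm_ttCircuit_le (hn : n = 2 ^ m) {ρ : QMatrix n} (hρ : IsState ρ) :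
    ∫ θ, sqGradNorm (objective (ttCircuit hn) ρ) θ ∂uniformParams (TTParam m) ≤ 2 * n - 1 := by
  have hn' : (n : ℝ) = 2 ^ m := by exact_mod_cast hn
  rw [hn', ← card_ttParam]
  exact integral_sqGradNorm_objective_le (nodup_params_ttCircuit hn) hρ

end TreeTensor

/-! ### The step-controlled circuit -/

section StepControlled

theorem params_scCircuit (n nc : ℕ) : params (scCircuit n nc) =
    (List.finRange n).map Sum.inl ++ (List.finRange (n - 1)).map Sum.inr := by
  rw [scCircuit, params_append, params, params, List.ofFn_eq_map, List.filterMap_map,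
    List.filterMap_flatMap, ← List.filterMap_eq_map, List.map_eq_flatMap]
  rfl

theorem nodup_params_scCircuit (n nc : ℕ) : (params (scCircuit n nc)).Nodup := by
  rw [params_scCircuit]
  exact ((List.nodup_finRange _).map Sum.inl_injective).append
    ((List.nodup_finRange _).map Sum.inr_injective) (by simp [List.disjoint_left])

theorem card_scParam (n : ℕ) [NeZero n] : (Fintype.card (SCParam n) : ℝ) = 2 * n - 1 := by
  rw [Fintype.card_sum, Fintype.card_fin, Fintype.card_fin]
  push_cast [Nat.cast_pred (NeZero.pos n)]
  ring

variable (n nc : ℕ) [NeZero n]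

theorem scCircuit_firstNotControl : ∀ g ∈ scCircuit n nc, g.FirstNotControl := by
  have hcontrol : ∀ i, scControl n i ≠ 0 := fun i =>
    Fin.val_ne_zero_iff.1 (show n - 1 - (i : ℕ) ≠ 0 by omega)
  rw [scCircuit, List.forall_mem_append, List.forall_mem_ofFn_iff, List.forall_mem_flatMap]
  refine ⟨fun _ => trivial, fun i _ => ?_⟩
  simpa [Gate.FirstNotControl] using hcontrol i

theorem foldl_momentStep_scCircuit (v : ℝ × ℝ) :
    (scCircuit n nc).foldl momentStep v =
      ((v.1 + v.2) / 2 / 2 ^ ({i | scTarget n nc i = 0} : Finset (Fin (n - 1))).card,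
        (v.1 + v.2) / 2 / 2 ^ ({i | scTarget n nc i = 0} : Finset (Fin (n - 1))).card) := by
  have hrot : (List.ofFn fun q : Fin n => (Gate.ry (Sum.inl q) q : Gate n (SCParam n))).foldl
      momentStep v = ((v.1 + v.2) / 2, (v.1 + v.2) / 2) := by
    rw [foldl_momentStep_ofFn]
    · simp [momentStep]
    · intro q hq v
      simp [momentStep, hq]
  have hcard : ({i | scTarget n nc i = 0} : Finset (Fin (n - 1))).card =
      (List.finRange (n - 1)).countP fun i => scTarget n nc i = 0 := by
    rw [List.countP_eq_length_filter]
    rfl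
  rw [hcard, scCircuit, List.foldl_append, hrot, List.foldl_flatMap,
    foldl_eq_div_two_pow_countP (p := fun i => scTarget n nc i = 0)]
  intro a i
  by_cases h : scTarget n nc i = 0 <;> simp [momentStep, h]

variable {n nc}

theorem card_scTarget_eq_zero (hlt : nc < n) (h0 : nc = 0 → n = 1) :
    ({i | scTarget n nc i = 0} : Finset (Fin (n - 1))).card = nc := by
  rcases eq_or_ne nc 0 with rfl | hnc
  · obtain rfl := h0 rfl
    simp
  · have hrev : ∀ i, scTarget n nc i = 0 ↔ (Fin.revPerm i : ℕ) < nc := fun i => by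
      simp only [Fin.ext_iff, scTarget, Fin.val_zero, Fin.revPerm_apply, Fin.val_rev]
      split_ifs <;> omega
    calc ({i | scTarget n nc i = 0} : Finset (Fin (n - 1))).card
        = ({i | (i : ℕ) < nc} : Finset (Fin (n - 1))).card :=
          Finset.card_equiv Fin.revPerm (by simp [hrev])
      _ = nc := by
          rw [Fin.card_filter_val_lt]
          omega

theorem le_integral_sqGradNorm_scCircuit (hlt : nc < n) (h0 : nc = 0 → n = 1) (ρ : QMatrix n) :
    (1 + nc) / 2 ^ (1 + nc) * alpha ρ ≤
      ∫ θ, sqGradNorm (objective (scCircuit n nc) ρ) θ ∂uniformParams (SCParam n) := by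
  set T : Finset (Fin (n - 1)) := {i | scTarget n nc i = 0} with hT
  have hmem : ∀ p ∈ ({0} : Finset (Fin n)).disjSum T, Gate.ry p 0 ∈ scCircuit n nc := by
    intro p hp
    rw [scCircuit, List.mem_append, List.mem_flatMap]
    rcases Finset.mem_disjSum.1 hp with ⟨q, hq, rfl⟩ | ⟨i, hi, rfl⟩
    · exact Or.inl (List.mem_ofFn.2 ⟨0, by rw [Finset.mem_singleton.1 hq]⟩)
    · refine Or.inr ⟨i, List.mem_finRange i, ?_⟩
      simp [(Finset.mem_filter.1 hi).2]
  have hbound := le_integral_sqGradNorm_objective (nodup_params_scCircuit n nc)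
    (scCircuit_firstNotControl n nc) ρ hmem
  rw [foldl_momentStep_scCircuit, ← alpha_eq, Finset.card_disjSum, Finset.card_singleton, hT,
    card_scTarget_eq_zero hlt h0] at hbound
  refine le_of_eq_of_le ?_ hbound
  rw [pow_add]
  push_cast
  field_simp

theorem integral_sqGradNorm_scCircuit_le (nc : ℕ) {ρ : QMatrix n} (hρ : IsState ρ) :
    ∫ θ, sqGradNorm (objective (scCircuit n nc) ρ) θ ∂uniformParams (SCParam n) ≤ 2 * n - 1 := by
  rw [← card_scParam]
  exact integral_sqGradNorm_objective_le (nodup_params_scCircuit n nc) hρ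

end StepControlled

end QNN

end

open QNN in
theorem theorem2 (n : ℕ) [NeZero n] (ρ : QMatrix n) (hρ : IsState ρ) :
    (∀ (m : ℕ) (hn : n = 2 ^ m),
      Differentiable ℝ (objective (ttCircuit hn) ρ) ∧
      Integrable (sqGradNorm (objective (ttCircuit hn) ρ)) (uniformParams (TTParam m)) ∧
      (1 + Real.logb 2 n) / (2 * n) * alpha ρ ≤
        ∫ θ, sqGradNorm (objective (ttCircuit hn) ρ) θ ∂(uniformParams (TTParam m)) ∧
      ∫ θ, sqGradNorm (objective (ttCircuit hn) ρ) θ ∂(uniformParams (TTParam m)) ≤ 2 * n - 1) ∧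
    (∀ nc : ℕ, nc < n → (nc = 0 → n = 1) →
      Differentiable ℝ (objective (scCircuit n nc) ρ) ∧
      Integrable (sqGradNorm (objective (scCircuit n nc) ρ)) (uniformParams (SCParam n)) ∧
      (1 + nc) / 2 ^ (1 + nc) * alpha ρ ≤
        ∫ θ, sqGradNorm (objective (scCircuit n nc) ρ) θ ∂(uniformParams (SCParam n)) ∧
      ∫ θ, sqGradNorm (objective (scCircuit n nc) ρ) θ ∂(uniformParams (SCParam n)) ≤
        2 * n - 1) := by
  exact
    ⟨fun m hn =>
      ⟨differentiable_objective _ ρ,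
        integrable_sqGradNorm_objective (nodup_params_ttCircuit hn) ρ,
        le_integral_sqGradNorm_ttCircuit hn ρ,
        integral_sqGradNorm_ttCircuit_le hn hρ⟩,
    fun nc hlt h0 =>
      ⟨differentiable_objective _ ρ,
        integrable_sqGradNorm_objective (nodup_params_scCircuit n nc) ρ,
        le_integral_sqGradNorm_scCircuit hlt h0 ρ,
        integral_sqGradNorm_scCircuit_le nc hρ⟩⟩
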